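/- Let $n\ge 0$, let $\mathbb{T}^n=U(1)^n$ be the $n$-torus, and let $N$ be a (finite-dimensional, Hausdorff) smooth manifold with a smooth free left action of $\mathbb{T}^n$. Let $\mathbb{T}^n$ act on the $C^*$-algebra $C_0(N)$ of continuous complex-valued functions vanishing at infinity by $\alpha_t(f)(x)=f(t^{-1}\cdot x)$, and let $C_0(N)^{\mathbb{T}^n}=\{f\in C_0(N):\alpha_t(f)=f\text{ for all }t\in\mathbb{T}^n\}$ be the fixed point algebra. For a character (continuous homomorphism) $\chi:\mathbb{T}^n\to U(1)$ let $$C_0(N)_\chi=\{f\in C_0(N):\alpha_t(f)=\chi(t)f\ \text{ for all } t\in\mathbb{T}^n\}$$ be the associated spectral subspace, and let $\overline{C_0(N)_\chi C_0(N)_\chi^*}$ be the norm closure of the linear span of the products $ab^*$ with $a,b\in C_0(N)_\chi$. For $k\in\mathbb{Z}^n$ write $C_0(N)_k=C_0(N)_{\chi_k}$, where $\chi_k(t)=t_1^{k_1}\cdots t_n^{k_n}$. Then $C_0(N)$ has full spectral subspaces, that is, $$\overline{C_0(N)_kC_0(N)_k^*}=C_0(N)^{\mathbb{T}^n}\qquad\text{for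 all }k\in\mathbb{Z}^n.$$ In particular, the action of $\mathbb{T}^n$ on $C_0(N)$ satisfies the spectral subspace assumption: for every character $\chi$ of $\mathbb{T}^n$, $\overline{C_0(N)_\chi C_0(N)_\chi^*}$ is a complemented ideal in $C_0(N)^{\mathbb{T}^n}$, i.e. a closed two-sided ideal $I$ for which there is a closed two-sided ideal $J$ of $C_0(N)^{\mathbb{T}^n}$ with $C_0(N)^{\mathbb{T}^n}=I\oplus J$. -/

import Mathlib

open scoped Manifold ContDiff ZeroAtInfty

section CStarDynamics

/-- The spectral subspace `A_χ = {a | α_g(a) = χ(g) a for all g}` of an action `α` of `G` on a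
C⋆-algebra `A`, for a continuous character `χ : G → U(1)`. -/
def spectralSubspace {G A : Type*} [Group G] [TopologicalSpace G] [NonUnitalCStarAlgebra A]
    (α : G →* (A ≃⋆ₐ[ℂ] A)) (χ : G →ₜ* Circle) : Submodule ℂ A where
  carrier := {a | ∀ g : G, α g a = (χ g : ℂ) • a}
  add_mem' := by
    intro a b ha hb g
    rw [map_add, ha g, hb g, smul_add]
  zero_mem' := by
    intro g
    rw [map_zero, smul_zero]
  smul_mem' := by
    intro c a ha g
    rw [map_smul, ha g, smul_comm]

/-- The fixed point algebra `A^G`. -/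
def fixedPointAlgebra {G A : Type*} [Group G] [NonUnitalCStarAlgebra A]
    (α : G →* (A ≃⋆ₐ[ℂ] A)) : NonUnitalStarSubalgebra ℂ A where
  carrier := {a | ∀ g : G, α g a = a}
  add_mem' := by
    intro a b ha hb g
    rw [map_add, ha g, hb g]
  zero_mem' := by
    intro g
    rw [map_zero]
  mul_mem' := by
    intro a b ha hb g
    rw [map_mul, ha g, hb g]
  smul_mem' := by
    intro c a ha g
    rw [map_smul, ha g]
  star_mem' := by
    intro a ha g
    rw [map_star, ha g]

/-- The norm closure of `A_χ A_χ^*`, where (as usual for a product of two subspaces of an algebra)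
`A_χ A_χ^*` is the linear span of the products `a b^*` with `a, b ∈ A_χ`. -/
def closedSpectralProduct {G A : Type*} [Group G] [TopologicalSpace G] [NonUnitalCStarAlgebra A]
    (α : G →* (A ≃⋆ₐ[ℂ] A)) (χ : G →ₜ* Circle) : Submodule ℂ A :=
  (Submodule.span ℂ {c : A | ∃ a ∈ spectralSubspace α χ, ∃ b ∈ spectralSubspace α χ,
    c = a * star b}).topologicalClosure

/-- `I` is a norm-closed two-sided ideal of the subalgebra `B` of `A`. -/
structure IsClosedIdealOf {A : Type*} [NonUnitalCStarAlgebra A]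
    (I : Submodule ℂ A) (B : NonUnitalStarSubalgebra ℂ A) : Prop where
  le : I ≤ B.toSubmodule
  isClosed : IsClosed (I : Set A)
  mul_mem_left : ∀ b ∈ B, ∀ x ∈ I, b * x ∈ I
  mul_mem_right : ∀ b ∈ B, ∀ x ∈ I, x * b ∈ I

/-- `I` is a complemented ideal of `B`: there is a closed ideal `J` of `B` with `B = I ⊕ J`. -/
def IsComplementedIdealOf {A : Type*} [NonUnitalCStarAlgebra A]
    (I : Submodule ℂ A) (B : NonUnitalStarSubalgebra ℂ A) : Prop :=
  IsClosedIdealOf I B ∧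
    ∃ J : Submodule ℂ A, IsClosedIdealOf J B ∧ I ⊓ J = ⊥ ∧ I ⊔ J = B.toSubmodule

/-- The spectral subspace assumption: for every character `χ` of `G`, the norm closure of
`A_χ A_χ^*` is a complemented ideal in the fixed point algebra `A^G`. -/
def SpectralSubspaceAssumption {G A : Type*} [Group G] [TopologicalSpace G]
    [NonUnitalCStarAlgebra A] (α : G →* (A ≃⋆ₐ[ℂ] A)) : Prop :=
  ∀ χ : G →ₜ* Circle, IsComplementedIdealOf (closedSpectralProduct α χ) (fixedPointAlgebra α)

end CStarDynamics

section Translation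

/-- The translate `x ↦ f (g⁻¹ • x)` of `f ∈ C₀(X)`. -/
noncomputable def translateC0 {G X : Type*} [Group G] [TopologicalSpace X] [MulAction G X]
    [ContinuousConstSMul G X] (g : G) (f : C₀(X, ℂ)) : C₀(X, ℂ) where
  toFun x := f (g⁻¹ • x)
  continuous_toFun := f.continuous.comp (continuous_const_smul g⁻¹)
  zero_at_infty' :=
    f.zero_at_infty'.comp (Homeomorph.smul g⁻¹ : X ≃ₜ X).isClosedEmbedding.tendsto_cocompact

/-- The action `α_g(f)(x) = f (g⁻¹ • x)` of `G` on the C⋆-algebra `C₀(X)` by `*`-automorphisms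
induced by an action of `G` on the space `X` by homeomorphisms. -/
noncomputable def translationAction (G X : Type*) [Group G] [TopologicalSpace X] [MulAction G X]
    [ContinuousConstSMul G X] : G →* (C₀(X, ℂ) ≃⋆ₐ[ℂ] C₀(X, ℂ)) where
  toFun g :=
    { toFun := translateC0 g
      invFun := translateC0 g⁻¹
      left_inv := fun f => by
        ext x
        simp [translateC0]
      right_inv := fun f => by
        ext x
        simp [translateC0]
      map_mul' := fun _ _ => rfl
      map_add' := fun _ _ => rfl
      map_star' := fun _ => rfl
      map_smul' := fun _ _ => rfl }
  map_one' := by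
    ext f x
    change f ((1 : G)⁻¹ • x) = f x
    simp
  map_mul' g h := by
    ext f x
    change f ((g * h)⁻¹ • x) = f (h⁻¹ • g⁻¹ • x)
    rw [mul_inv_rev, mul_smul]

end Translation

section Torus

/-- The `n`-torus `𝕋ⁿ`, a product of `n` copies of the unit circle in `ℂ`, with Mathlib's product
group structure, topology and charts. -/
abbrev Torus (n : ℕ) : Type := Fin n → Circle

/-- The model on which the product charts of the `n`-torus are smooth. -/
noncomputable abbrev torusModel (n : ℕ) :
    ModelWithCorners ℝ (Fin n → EuclideanSpace ℝ (Fin 1))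
      (ModelPi fun _ : Fin n => EuclideanSpace ℝ (Fin 1)) :=
  ModelWithCorners.pi fun _ : Fin n => 𝓡 1

/-- The character `χ_k(t) = t₁^{k₁} ⋯ tₙ^{kₙ}` of the `n`-torus, for `k ∈ ℤⁿ`; at
`t = (exp (2πi s₁), …, exp (2πi sₙ))` its value is `exp (2πi s · k)`. -/
noncomputable def torusCharacter {n : ℕ} (k : Fin n → ℤ) : Torus n →ₜ* Circle where
  toFun t := ∏ j, t j ^ k j
  map_one' := by simp
  map_mul' s t := by simp [mul_zpow, Finset.prod_mul_distrib]
  continuous_toFun := continuous_finsetProd _ fun j _ => (continuous_apply j).zpow (k j)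

end Torus

/-! Freeness ensures that no point is a common zero of a spectral subspace: a bump function at `x`,
averaged over Haar measure against `χ`, lies in the `χ`-subspace and is nonzero at `x` if the bump
is chosen to vanish on the part of the orbit where `Re χ` is not positive. A partition-of-unity
argument then gives fullness. For invariant `f`, take finitely many `a_i` in the subspace with no
common zero on the compact set `{ε/2 ≤ |f|}`, and put `h = ∑ |a_i|²`. For a small constant `m > 0`,
the function `f h / max(h, m)` is a sum of products `b_i a_i^*` and is uniformly close to `f`. Hence
every closed product is the whole fixed point algebra, with complement `0`. -/

@[simp]
theorem translationAction_apply {G X : Type*} [Group G] [TopologicalSpace X] [MulAction G X]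
    [ContinuousConstSMul G X] (g : G) (f : C₀(X, ℂ)) (x : X) :
    translationAction G X g f x = f (g⁻¹ • x) := rfl

section Averaging

open MeasureTheory

variable {G X : Type*} [Group G] [TopologicalSpace G] [IsTopologicalGroup G] [CompactSpace G]
  [TopologicalSpace X] [MulAction G X] [ContinuousSMul G X]

/-- The average of a function with compact support against a character, as a function vanishing
at infinity. -/
theorem exists_spectralSubspace_eq_integral [MeasurableSpace G] [BorelSpace G] [T2Space X]
    (μ : Measure G) [IsFiniteMeasure μ] [μ.IsMulLeftInvariant]
    (χ : G →ₜ* Circle) {f : X → ℂ} (hf : Continuous f) (hfc : HasCompactSupport f) :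
    ∃ a ∈ spectralSubspace (translationAction G X) χ,
      ∀ y, a y = ∫ t, (χ t⁻¹ : ℂ) * f (t⁻¹ • y) ∂μ := by
  have hcont : Continuous fun y => ∫ t, (χ t⁻¹ : ℂ) * f (t⁻¹ • y) ∂μ := by
    rw [← continuousOn_univ]
    refine continuousOn_integral_of_compact_support (k := Set.univ) isCompact_univ ?_ (by simp)
    have : Continuous fun p : X × G => (χ p.2⁻¹ : ℂ) * f (p.2⁻¹ • p.1) := by fun_prop
    exact this.continuousOn
  have hsupp : HasCompactSupport fun y => ∫ t, (χ t⁻¹ : ℂ) * f (t⁻¹ • y) ∂μ := by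
    -- The average vanishes off the saturation `G • tsupport f`, which is compact because `G` is.
    refine HasCompactSupport.intro
      (K := (fun p : G × X => p.1 • p.2) '' (Set.univ ×ˢ tsupport f))
      ((isCompact_univ.prod hfc).image continuous_smul) fun y hy => ?_
    have : ∀ t : G, f (t⁻¹ • y) = 0 := fun t => by
      refine image_eq_zero_of_notMem_tsupport fun h => hy ⟨(t, t⁻¹ • y), ⟨trivial, h⟩, ?_⟩
      simp
    simp [this]
  refine ⟨⟨⟨_, hcont⟩, hsupp.is_zero_at_infty⟩, fun s => ?_, fun y => rfl⟩
  ext y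
  change ∫ t, (χ t⁻¹ : ℂ) * f (t⁻¹ • s⁻¹ • y) ∂μ =
    (χ s : ℂ) * ∫ t, (χ t⁻¹ : ℂ) * f (t⁻¹ • y) ∂μ
  rw [← integral_const_mul, ← integral_mul_left_eq_self
    (fun t => (χ s : ℂ) * ((χ t⁻¹ : ℂ) * f (t⁻¹ • y))) s]
  refine integral_congr_ae (.of_forall fun t => ?_)
  have : (χ s : ℂ) * χ (s * t)⁻¹ = χ t⁻¹ := by
    rw [← Circle.coe_mul, mul_inv_rev, map_mul, mul_left_comm, ← map_mul χ s, mul_inv_cancel, map_one, mul_one]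
  change (χ t⁻¹ : ℂ) * f (t⁻¹ • s⁻¹ • y) = χ s * (χ (s * t)⁻¹ * f ((s * t)⁻¹ • y))
  rw [← mul_assoc, this, mul_inv_rev, mul_smul]

/-- For a free action of a compact group, no point is a common zero of a spectral subspace. -/
theorem exists_spectralSubspace_apply_ne_zero [T2Space X] [LocallyCompactSpace X]
    (free : ∀ (t : G) (x : X), t • x = x → t = 1) (χ : G →ₜ* Circle) (x : X) :
    ∃ a ∈ spectralSubspace (translationAction G X) χ, a x ≠ 0 := by
  let _ : MeasurableSpace G := borel G
  have : BorelSpace G := ⟨rfl⟩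
  have hχ : Continuous fun t : G => (χ t⁻¹ : ℂ).re := by fun_prop
  -- Disjointness is where freeness enters: `t⁻¹ • x = x` forces `t = 1`, where `Re χ = 1 > 0`.
  obtain ⟨f, hf0, hf1, hfc, hf⟩ := exists_continuous_one_zero_of_isCompact (X := X)
    (s := {x}) (t := (fun t : G => t⁻¹ • x) '' {t | (χ t⁻¹ : ℂ).re ≤ 0}) isCompact_singleton
    (((isClosed_le hχ continuous_const).isCompact.image (by fun_prop)).isClosed) (by
      rw [Set.disjoint_singleton_left]
      rintro ⟨t, ht, htx⟩
      have : t⁻¹ = 1 := free _ _ htx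
      simp only [Set.mem_ofPred_eq, this, map_one, Circle.coe_one, Complex.one_re] at ht
      linarith)
  obtain ⟨a, ha, hax⟩ := exists_spectralSubspace_eq_integral (X := X)
    (Measure.haar : Measure G) χ (f := fun y => (f y : ℂ)) (by fun_prop)
    (hfc.comp_left Complex.ofReal_zero)
  refine ⟨a, ha, fun h => ?_⟩
  have hF : Continuous fun t : G => (χ t⁻¹ : ℂ) * (f (t⁻¹ • x) : ℂ) := by fun_prop
  have hint : Integrable (fun t : G => (χ t⁻¹ : ℂ) * (f (t⁻¹ • x) : ℂ)) Measure.haar :=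
    hF.integrable_of_hasCompactSupport (HasCompactSupport.of_compactSpace _)
  have hre : ∫ t : G, (χ t⁻¹ : ℂ).re * f (t⁻¹ • x) ∂Measure.haar = 0 := by
    have := Complex.reCLM.integral_comp_comm hint
    rw [← hax, h] at this
    simpa using this
  -- The integrand is continuous, nonnegative by the choice of `f`, and equal to `1` at `t = 1`;
  -- Haar measure charges open sets.
  refine (integral_pos_of_integrable_nonneg_nonzero (μ := (Measure.haar : Measure G)) (x := 1)
    (f := fun t : G => (χ t⁻¹ : ℂ).re * f (t⁻¹ • x)) (by fun_prop) ?_ ?_ ?_).ne' hre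
  · simpa using hint.re
  · intro t
    rcases le_or_gt (χ t⁻¹ : ℂ).re 0 with ht | ht
    · have : f (t⁻¹ • x) = 0 := hf1 ⟨t, ht, rfl⟩
      simp [this]
    · exact mul_nonneg ht.le (hf _).1
  · have : f x = 1 := hf0 rfl
    simp [this]

end Averaging

section FullSpectralSubspaces

variable {G X : Type*} [Group G] [TopologicalSpace X] [MulAction G X] [ContinuousConstSMul G X]

theorem isClosed_fixedPointAlgebra_translationAction :
    IsClosed (fixedPointAlgebra (translationAction G X) : Set C₀(X, ℂ)) := by
  have heval : ∀ x : X, Continuous fun f : C₀(X, ℂ) => f x := fun x =>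
    (BoundedContinuousFunction.lipschitz_eval_const x).continuous.comp
      ZeroAtInftyContinuousMap.isometry_toBCF.continuous
  have : (fixedPointAlgebra (translationAction G X) : Set C₀(X, ℂ)) =
      ⋂ (g : G) (x : X), {f | f (g⁻¹ • x) = f x} := by
    ext f
    simp only [Set.mem_iInter, Set.mem_ofPred_eq]
    exact forall_congr' fun g => DFunLike.ext_iff
  rw [this]
  exact isClosed_iInter fun g => isClosed_iInter fun x => isClosed_eq (heval _) (heval _)

variable [TopologicalSpace G]

theorem mul_star_mem_fixedPointAlgebra {A : Type*} [NonUnitalCStarAlgebra A]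
    {α : G →* (A ≃⋆ₐ[ℂ] A)} {χ : G →ₜ* Circle} {a b : A} (ha : a ∈ spectralSubspace α χ)
    (hb : b ∈ spectralSubspace α χ) : a * star b ∈ fixedPointAlgebra α := by
  intro g
  rw [map_mul, map_star, ha g, hb g, star_smul, smul_mul_smul_comm]
  have : (χ g : ℂ) * star (χ g : ℂ) = 1 := by
    rw [Complex.star_def, Complex.mul_conj, Circle.normSq_coe, Complex.ofReal_one]
  rw [this, one_smul]

theorem closedSpectralProduct_translationAction_le (χ : G →ₜ* Circle) :
    closedSpectralProduct (translationAction G X) χ ≤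
      (fixedPointAlgebra (translationAction G X)).toSubmodule := by
  refine Submodule.topologicalClosure_minimal _ (Submodule.span_le.2 ?_)
    isClosed_fixedPointAlgebra_translationAction
  rintro _ ⟨a, ha, b, hb, rfl⟩
  exact mul_star_mem_fixedPointAlgebra ha hb

/-- An invariant bounded multiplier maps each spectral subspace to itself. -/
theorem exists_spectralSubspace_eq_mul (χ : G →ₜ* Circle) {a : C₀(X, ℂ)}
    (ha : a ∈ spectralSubspace (translationAction G X) χ) {u : X → ℂ} (hu : Continuous u)
    (hinv : ∀ (g : G) x, u (g • x) = u x) {C : ℝ} (hC : ∀ x, ‖u x‖ ≤ C) :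
    ∃ b ∈ spectralSubspace (translationAction G X) χ, ∀ x, b x = u x * a x := by
  refine ⟨⟨⟨fun x => u x * a x, hu.mul a.continuous⟩, ?_⟩, fun g => ?_, fun x => rfl⟩
  · refine squeeze_zero_norm (a := fun x => C * ‖a x‖) (fun x => ?_) ?_
    · simpa using mul_le_mul_of_nonneg_right (hC x) (norm_nonneg (a x))
    · simpa using (zero_at_infty a).norm.const_mul C
  · ext x
    have h : a (g⁻¹ • x) = (χ g : ℂ) * a x := DFunLike.congr_fun (ha g) x
    change u (g⁻¹ • x) * a (g⁻¹ • x) = (χ g : ℂ) * (u x * a x)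
    rw [hinv, h, mul_left_comm]

/-- If a spectral subspace of `C₀(X)` has no common zero then it is full. -/
theorem closedSpectralProduct_translationAction_eq (χ : G →ₜ* Circle)
    (hχ : ∀ x : X, ∃ a ∈ spectralSubspace (translationAction G X) χ, a x ≠ 0) :
    closedSpectralProduct (translationAction G X) χ =
      (fixedPointAlgebra (translationAction G X)).toSubmodule := by
  refine le_antisymm (closedSpectralProduct_translationAction_le χ) fun f hf => ?_
  refine Metric.mem_closure_iff.2 fun ε hε => ?_
  choose a ha hax using hχ
  have hK : IsCompact {x | ε / 2 ≤ ‖f x‖} := by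
    have h := (zero_at_infty f).norm.eventually_lt_const (u := ε / 2) (by simpa using half_pos hε)
    obtain ⟨K, hK, hKf⟩ := Filter.mem_cocompact.1 h
    refine hK.of_isClosed_subset (isClosed_le continuous_const (by fun_prop)) fun x hx => ?_
    by_contra hxK
    exact (show ‖f x‖ < ε / 2 from hKf hxK).not_ge hx
  obtain ⟨s, -, hs⟩ := hK.elim_nhds_subcover (fun x => {y | a x y ≠ 0}) fun x _ =>
    (isOpen_ne_fun (a x).continuous continuous_const).mem_nhds (hax x)
  set h : X → ℝ := fun y => ∑ x ∈ s, Complex.normSq (a x y) with h_def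
  have hcont : Continuous h := by
    refine continuous_finsetSum _ fun x _ => Complex.continuous_normSq.comp (a x).continuous
  have h0 : ∀ y, 0 ≤ h y := fun y => Finset.sum_nonneg fun x _ => Complex.normSq_nonneg _
  -- `m` bounds `h` from below on the compact set, so `(max h m)⁻¹` is continuous and bounded
  -- everywhere and equals `h⁻¹` there.
  obtain ⟨m, hm, hmK⟩ := hK.exists_forall_le' (a := 0) hcont.continuousOn fun y hy => by
    obtain ⟨x, hxs, hxy⟩ := Set.mem_iUnion₂.1 (hs hy)
    exact Finset.sum_pos' (fun x _ => Complex.normSq_nonneg _)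
      ⟨x, hxs, Complex.normSq_pos.2 hxy⟩
  have hmax : ∀ y, 0 < max (h y) m := fun y => hm.trans_le (le_max_right _ _)
  have hfinv : ∀ (g : G) y, f (g • y) = f y := fun g y => by
    have := DFunLike.congr_fun (hf g) (g • y)
    rw [translationAction_apply, inv_smul_smul] at this
    exact this.symm
  -- Translation changes each `a x` only by a phase, which `normSq` does not see.
  have hinv : ∀ (g : G) y, h (g • y) = h y := fun g y => by
    refine Finset.sum_congr rfl fun x _ => ?_
    have := DFunLike.congr_fun (ha x g) (g • y)
    rw [translationAction_apply, inv_smul_smul, ZeroAtInftyContinuousMap.smul_apply,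
      smul_eq_mul] at this
    rw [this, Complex.normSq_mul, Circle.normSq_coe, one_mul]
  have hb : ∀ x, ∃ b ∈ spectralSubspace (translationAction G X) χ,
      ∀ y, b y = (f y * ((max (h y) m)⁻¹ : ℝ)) * a x y := fun x => by
    refine exists_spectralSubspace_eq_mul χ (ha x) (C := ‖f‖ * m⁻¹) ?_ ?_ ?_
    · exact f.continuous.mul (Complex.continuous_ofReal.comp
        ((hcont.max continuous_const).inv₀ fun y => (hmax y).ne'))
    · intro g y
      rw [hfinv, hinv]
    · intro y
      rw [norm_mul, Complex.norm_real, Real.norm_of_nonneg (inv_pos.2 (hmax y)).le]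
      exact mul_le_mul (f.toBCF.norm_coe_le_norm y) (inv_anti₀ hm (le_max_right _ _))
        (inv_pos.2 (hmax y)).le (norm_nonneg _)
  choose b hb hbx using hb
  refine ⟨∑ x ∈ s, b x * star (a x), Submodule.sum_mem _ fun x _ =>
    Submodule.subset_span ⟨b x, hb x, a x, ha x, rfl⟩, ?_⟩
  refine lt_of_le_of_lt ?_ (half_lt_self hε)
  rw [← ZeroAtInftyContinuousMap.dist_toBCF_eq_dist,
    BoundedContinuousFunction.dist_le (half_pos hε).le]
  intro y
  have hy : (∑ x ∈ s, b x * star (a x)) y = f y * ((max (h y) m)⁻¹ * h y : ℝ) := by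
    let ev : C₀(X, ℂ) →+ ℂ := ⟨⟨fun f => f y, rfl⟩, fun _ _ => rfl⟩
    change ev (∑ x ∈ s, b x * star (a x)) = _
    rw [map_sum, h_def]
    push_cast
    rw [Finset.mul_sum, Finset.mul_sum]
    refine Finset.sum_congr rfl fun x _ => ?_
    change b x y * star (a x y) = _
    rw [hbx, Complex.normSq_eq_conj_mul_self, Complex.star_def]
    push_cast
    ring
  change dist (f y) ((∑ x ∈ s, b x * star (a x)) y) ≤ ε / 2
  rw [hy]
  -- Where `|f| ≥ ε/2` the approximation is exact; elsewhere `f` is scaled by a factor in `[0, 1]`,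
  -- so the error is at most `|f| < ε/2`.
  by_cases hyK : ε / 2 ≤ ‖f y‖
  · rw [max_eq_left (hmK y hyK), inv_mul_cancel₀ (hm.trans_le (hmK y hyK)).ne']
    simpa using (half_pos hε).le
  · have h1 : (max (h y) m)⁻¹ * h y ≤ 1 := by
      rw [inv_mul_le_one₀ (hmax y)]
      exact le_max_left _ _
    have h2 : 0 ≤ (max (h y) m)⁻¹ * h y := mul_nonneg (inv_pos.2 (hmax y)).le (h0 y)
    have h3 : f y - f y * ((max (h y) m)⁻¹ * h y : ℝ) =
        f y * ((1 - (max (h y) m)⁻¹ * h y : ℝ) : ℂ) := by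
      push_cast
      ring
    rw [dist_eq_norm, h3, norm_mul, Complex.norm_real, Real.norm_of_nonneg (by linarith)]
    exact (mul_le_of_le_one_right (norm_nonneg _) (by linarith)).trans (not_le.1 hyK).le

end FullSpectralSubspaces

/-- A closed subalgebra is a complemented ideal in itself. -/
theorem isComplementedIdealOf_self {A : Type*} [NonUnitalCStarAlgebra A]
    {B : NonUnitalStarSubalgebra ℂ A} (hB : IsClosed (B : Set A)) :
    IsComplementedIdealOf B.toSubmodule B := by
  refine ⟨⟨le_rfl, hB, fun b hb x hx => B.mul_mem hb hx, fun b hb x hx => B.mul_mem hx hb⟩, ⊥,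
    ⟨bot_le, isClosed_singleton, fun b _ x hx => ?_, fun b _ x hx => ?_⟩, inf_bot_eq _,
    sup_bot_eq _⟩
  · rw [(Submodule.mem_bot ℂ).1 hx, mul_zero]
    exact zero_mem _
  · rw [(Submodule.mem_bot ℂ).1 hx, zero_mul]
    exact zero_mem _

theorem mainTheorem9 (n : ℕ)
    {E : Type*} [NormedAddCommGroup E] [NormedSpace ℝ E] [FiniteDimensional ℝ E]
    {H : Type*} [TopologicalSpace H] (I : ModelWithCorners ℝ E H)
    (N : Type*) [TopologicalSpace N] [T2Space N] [ChartedSpace H N] [IsManifold I ∞ N]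
    [MulAction (Torus n) N]
    (smooth : ContMDiffSMul (torusModel n) I ∞ (Torus n) N)
    (free : ∀ (t : Torus n) (x : N), t • x = x → t = 1) :
    haveI : ContinuousSMul (Torus n) N := smooth.continuousSMul
    (∀ k : Fin n → ℤ,
      closedSpectralProduct (translationAction (Torus n) N) (torusCharacter k) =
        (fixedPointAlgebra (translationAction (Torus n) N)).toSubmodule) ∧
    SpectralSubspaceAssumption (translationAction (Torus n) N) := by
  have : ContinuousSMul (Torus n) N := smooth.continuousSMul
  -- Beyond continuity of the action, the manifold structure serves only to supply local
  -- compactness, needed for the bump functions.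
  have : LocallyCompactSpace N := Manifold.locallyCompact_of_finiteDimensional I
  have full : ∀ χ : Torus n →ₜ* Circle,
      closedSpectralProduct (translationAction (Torus n) N) χ =
        (fixedPointAlgebra (translationAction (Torus n) N)).toSubmodule := fun χ =>
    closedSpectralProduct_translationAction_eq χ
      (exists_spectralSubspace_apply_ne_zero free χ)
  refine ⟨fun k => full _, fun χ => ?_⟩
  rw [full χ]
  exact isComplementedIdealOf_self isClosed_fixedPointAlgebra_translationAction
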